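/- Let $X$ be an Archimedean real vector lattice. Let $Y$ be an Archimedean real vector lattice with a Hausdorff linear topology $\tau$ that is locally convex and locally solid (zero has a base of solid neighbourhoods) and Lebesgue (every net $y_\alpha\downarrow 0$ in $Y$ satisfies $y_\alpha\xrightarrow{\tau}0$). Assume that $Y$ is Dedekind complete or that $(Y,\tau)$ is complete. Let $L_r(X,Y)$ be the space of regular operators from $X$ to $Y$ (differences of two positive linear operators), ordered by $S\le T$ iff $Sx\le Tx$ for all $x\in X_+$; call a linear operator $T:X\to Y$ $o\tau$-compact if $T[0,x]$ is $\tau$-totally bounded for every $x\in X_+$. Then $L_r(X,Y)$ is a vector lattice, and the set of all $o\tau$-compact operators in $L_r(X,Y)$ is a band of $L_r(X,Y)$, that is, a linear subspace which contains $S$ whenever $|S|\le|T|$ for some member $T$, and which contains the supremum in $L_r(X,Y)$ of each of its subsets that has one. -/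

import Mathlib

/-- A vector lattice is Archimedean if `0 ≤ n x ≤ y` for all `n` forces `x = 0`. (Mathlib's
`Archimedean` is the notion for linearly ordered groups, which is much stronger here.) -/
class ArchimedeanLattice (E : Type*) [AddCommGroup E] [Lattice E] : Prop where
  eq_zero_of_nsmul_le : ∀ x y : E, 0 ≤ x → (∀ n : ℕ, n • x ≤ y) → x = 0

/-- Every nonempty set that is bounded above has a supremum. -/
def IsDedekindComplete (E : Type*) [Lattice E] : Prop :=
  ∀ s : Set E, s.Nonempty → BddAbove s → ∃ a, IsLUB s a

/-- The topology has a base at zero consisting of solid sets. -/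
def IsLocallySolid (E : Type*) [AddCommGroup E] [Lattice E] [TopologicalSpace E] : Prop :=
  ∀ U ∈ nhds (0 : E), ∃ V ∈ nhds (0 : E), LatticeOrderedAddCommGroup.IsSolid V ∧ V ⊆ U

/-- Every net that decreases to zero converges to zero. Nets indexed in the universe of `E` are
enough, since a decreasing net can be replaced by its range with the reverse order. -/
def IsLebesgueTopology.{u} (E : Type u) [AddCommGroup E] [Lattice E] [TopologicalSpace E] : Prop :=
  ∀ (ι : Type u) [Preorder ι] [IsDirectedOrder ι] [Nonempty ι] (x : ι → E),
    Antitone x → IsGLB (Set.range x) 0 → Filter.Tendsto x Filter.atTop (nhds 0)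

/-- A band of a vector lattice `E`: a linear subspace that is solid (hence an order ideal) and
contains the supremum in `E` of each of its subsets that has one. -/
structure IsBand {E : Type*} [AddCommGroup E] [Module ℝ E] [Lattice E] (B : Set E) : Prop where
  zero_mem : (0 : E) ∈ B
  add_mem : ∀ {x y : E}, x ∈ B → y ∈ B → x + y ∈ B
  smul_mem : ∀ (c : ℝ) {x : E}, x ∈ B → c • x ∈ B
  solid : LatticeOrderedAddCommGroup.IsSolid B
  isLUB_mem : ∀ (D : Set E) (a : E), D ⊆ B → IsLUB D a → a ∈ B

section Operators

variable {X : Type*} [AddCommGroup X] [Lattice X] [IsOrderedAddMonoid X] [Module ℝ X]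
  [IsOrderedModule ℝ X]
variable {Y : Type*} [AddCommGroup Y] [Lattice Y] [IsOrderedAddMonoid Y] [Module ℝ Y]
  [IsOrderedModule ℝ Y]

/-- A positive linear operator. -/
def IsPositiveOperator (T : X →ₗ[ℝ] Y) : Prop := ∀ x : X, 0 ≤ x → 0 ≤ T x

variable (X Y) in
/-- The space of regular operators, i.e. of differences of two positive operators. -/
def RegularOperators : Submodule ℝ (X →ₗ[ℝ] Y) where
  carrier := {T | ∃ P Q : X →ₗ[ℝ] Y, IsPositiveOperator P ∧ IsPositiveOperator Q ∧ T = P - Q}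
  zero_mem' := ⟨0, 0, fun _ _ => le_rfl, fun _ _ => le_rfl, by simp⟩
  add_mem' := by
    rintro _ _ ⟨P, Q, hP, hQ, rfl⟩ ⟨P', Q', hP', hQ', rfl⟩
    exact ⟨P + P', Q + Q', fun x hx => add_nonneg (hP x hx) (hP' x hx),
      fun x hx => add_nonneg (hQ x hx) (hQ' x hx), by abel⟩
  smul_mem' := by
    rintro c _ ⟨P, Q, hP, hQ, rfl⟩
    rcases le_total 0 c with hc | hc
    · exact ⟨c • P, c • Q, fun x hx => smul_nonneg hc (hP x hx),
        fun x hx => smul_nonneg hc (hQ x hx), smul_sub c P Q⟩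
    · exact ⟨(-c) • Q, (-c) • P, fun x hx => smul_nonneg (neg_nonneg.2 hc) (hQ x hx),
        fun x hx => smul_nonneg (neg_nonneg.2 hc) (hP x hx), by module⟩

/-- The operator order: `S ≤ T` if and only if `S x ≤ T x` for all `x ≥ 0`. -/
instance RegularOperators.instPartialOrder : PartialOrder (RegularOperators X Y) where
  le S T := ∀ x : X, 0 ≤ x → S.1 x ≤ T.1 x
  le_refl _ _ _ := le_rfl
  le_trans _ _ _ h h' x hx := (h x hx).trans (h' x hx)
  le_antisymm S T h h' := by
    have key : ∀ x : X, 0 ≤ x → S.1 x = T.1 x := fun x hx => le_antisymm (h x hx) (h' x hx)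
    ext x
    rw [← posPart_sub_negPart x, map_sub, map_sub, key _ (posPart_nonneg x),
      key _ (negPart_nonneg x)]

instance RegularOperators.instIsOrderedAddMonoid : IsOrderedAddMonoid (RegularOperators X Y) where
  add_le_add_left _ _ h R x hx := add_le_add_left (h x hx) (R.1 x)

instance RegularOperators.instIsOrderedModule : IsOrderedModule ℝ (RegularOperators X Y) where
  smul_le_smul_of_nonneg_left _ hc _ _ h x hx := smul_le_smul_of_nonneg_left (h x hx) hc
  smul_le_smul_of_nonneg_right R hR _ _ h x hx :=
    smul_le_smul_of_nonneg_right h (show 0 ≤ R.1 x from hR x hx)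

/-- An operator is `oτ`-compact if it maps each order interval `[0, x]` to a totally bounded set. -/
def IsOTauCompact [UniformSpace Y] (T : X →ₗ[ℝ] Y) : Prop :=
  ∀ x : X, 0 ≤ x → TotallyBounded (T '' Set.Icc 0 x)

end Operators

/-! If $Y$ is only $\tau$-complete, the Lebesgue property makes it Dedekind complete, so the
Riesz-Kantorovich formula always gives the lattice structure. The crux is
`IsOTauCompact.of_disjoint`. For $y\in[0,x]$ put $w=A(x-y)+By$. Splitting $z\in[0,x]$ along
$x=(x-y)+y$ approximates $Az$ from below, within $2w$, by the totally bounded set $T[0,x]-w$.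
Disjointness of $A$ and $B$ makes the infimum of all $w$ zero. Since joins of lower approximants
turn errors into their meets, finite infima of errors are allowed too, and the Lebesgue property
makes one of them small.

With $A=T^+$, compact operators form a sublattice; with $A$ a component of $T\ge 0$, components of
$T$ are compact. A dyadic version of Freudenthal's theorem then approximates any $0\le S\le T$
within $2^{-n}T$, giving solidity. Directed suprema are pointwise, and the Lebesgue property makes
the approximation uniform on $[0,x]$. -/

/-! ### Locally solid and Lebesgue topologies -/

section Topology

variable {Y : Type*} [AddCommGroup Y] [Lattice Y] [IsOrderedAddMonoid Y]

/-- Locally solid group topologies have arbitrarily small neighbourhoods `V` such that everything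
dominated by a sum of two moduli of elements of `V` is still small. -/
theorem IsLocallySolid.exists_nhds_abs_add [TopologicalSpace Y] [ContinuousAdd Y]
    (hY : IsLocallySolid Y) {U : Set Y} (hU : U ∈ nhds (0 : Y)) :
    ∃ V ∈ nhds (0 : Y), ∀ v ∈ V, ∀ w ∈ V, ∀ y : Y, |y| ≤ |v| + |w| → y ∈ U := by
  obtain ⟨U', hU', hsol, hsub⟩ := hY U hU
  obtain ⟨V, hV, hVU⟩ := exists_nhds_zero_half hU'
  obtain ⟨W, hW, hWsol, hWV⟩ := hY V hV
  refine ⟨W, hW, fun v hv w hw y hy => hsub ?_⟩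
  have h1 : |v| ∈ V := hWV (hWsol hv (abs_abs v).le)
  have h2 : |w| ∈ V := hWV (hWsol hw (abs_abs w).le)
  exact hsol (hVU _ h1 _ h2) (hy.trans (le_abs_self _))

/-- In a Lebesgue topology a downward directed set with infimum zero meets every neighbourhood of
zero. -/
theorem IsLebesgueTopology.exists_mem_nhds [TopologicalSpace Y] (hY : IsLebesgueTopology Y)
    {W : Set Y} (hne : W.Nonempty) (hdir : DirectedOn (fun a b => b ≤ a) W) (hW : IsGLB W 0)
    {U : Set Y} (hU : U ∈ nhds (0 : Y)) : ∃ w ∈ W, w ∈ U := by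
  have : Nonempty Wᵒᵈ := hne.to_subtype.map OrderDual.toDual
  have : IsDirectedOrder Wᵒᵈ := ⟨fun a b => by
    obtain ⟨c, hc, hca, hcb⟩ := hdir _ (OrderDual.ofDual a).2 _ (OrderDual.ofDual b).2
    exact ⟨OrderDual.toDual ⟨c, hc⟩, hca, hcb⟩⟩
  have h := hY Wᵒᵈ (fun i => ((OrderDual.ofDual i : W) : Y)) (fun _ _ h => h)
    (by
      have : Set.range (fun i : Wᵒᵈ => ((OrderDual.ofDual i : W) : Y)) = W := Subtype.range_coe
      rwa [this])
  obtain ⟨i, hi⟩ := (h.eventually hU).exists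
  exact ⟨_, (OrderDual.ofDual i).2, hi⟩

theorem abs_sup_sub_sup_le_add (a b c d : Y) : |a ⊔ b - c ⊔ d| ≤ |a - c| + |b - d| := by
  have h1 := abs_sup_sub_sup_le_abs a c b
  have h2 := abs_sup_sub_sup_le_abs b d c
  rw [sup_comm b c, sup_comm d c] at h2
  calc |a ⊔ b - c ⊔ d| = |(a ⊔ b - c ⊔ b) + (c ⊔ b - c ⊔ d)| := by abel_nf
    _ ≤ _ := (abs_add_le _ _).trans (add_le_add h1 h2)

theorem IsLocallySolid.continuous_posPart [TopologicalSpace Y] [IsTopologicalAddGroup Y]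
    (hY : IsLocallySolid Y) : Continuous fun y : Y => y ⊔ 0 := by
  rw [continuous_iff_continuousAt]
  intro y
  have key : Filter.Tendsto (fun z : Y => z ⊔ 0 - y ⊔ 0) (nhds y) (nhds 0) := by
    intro U hU
    obtain ⟨V, hV, hsol, hVU⟩ := hY U hU
    have h : Filter.Tendsto (fun z : Y => z - y) (nhds y) (nhds 0) := by
      simpa using (Filter.tendsto_id (x := nhds y)).sub_const y
    rw [Filter.mem_map]
    filter_upwards [h.eventually_mem hV] with z hz
    exact hVU (hsol hz (abs_sup_sub_sup_le_abs z y 0))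
  simpa [ContinuousAt] using key.add_const (y ⊔ 0)

theorem IsLocallySolid.orderClosedTopology [TopologicalSpace Y] [IsTopologicalAddGroup Y]
    [T2Space Y] (hY : IsLocallySolid Y) : OrderClosedTopology Y := by
  refine ⟨?_⟩
  have : {p : Y × Y | p.1 ≤ p.2} = {p : Y × Y | (p.2 - p.1) ⊔ 0 = p.2 - p.1} := by
    ext p; simp
  rw [this]
  exact isClosed_eq (hY.continuous_posPart.comp (continuous_snd.sub continuous_fst))
    (continuous_snd.sub continuous_fst)

section Uniform

variable [UniformSpace Y] [IsUniformAddGroup Y]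

theorem IsLocallySolid.totallyBounded_image2 (hY : IsLocallySolid Y) {f : Y → Y → Y}
    (hf : ∀ a b c d, |f a b - f c d| ≤ |a - c| + |b - d|) {K L : Set Y}
    (hK : TotallyBounded K) (hL : TotallyBounded L) : TotallyBounded (Set.image2 f K L) := by
  rw [totallyBounded_iff_subset_finite_iUnion_nhds_zero] at *
  intro U hU
  obtain ⟨V, hV, hVU⟩ := hY.exists_nhds_abs_add hU
  obtain ⟨s, hs, hKs⟩ := hK V hV
  obtain ⟨t, ht, hLt⟩ := hL V hV
  refine ⟨Set.image2 f s t, hs.image2 f ht, ?_⟩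
  rintro _ ⟨a, ha, b, hb, rfl⟩
  obtain ⟨c, hc, v, hv, rfl⟩ := Set.mem_iUnion₂.1 (hKs ha)
  obtain ⟨d, hd, w, hw, rfl⟩ := Set.mem_iUnion₂.1 (hLt hb)
  refine Set.mem_iUnion₂.2 ⟨f c d, Set.mem_image2_of_mem hc hd,
    f (c +ᵥ v) (d +ᵥ w) - f c d, hVU v hv w hw _ ?_, by simp⟩
  simpa using hf (c + v) (d + w) c d

/-- Solidity turns the order error $v$, common to all of `s`, into a topological one, so a finite
net for `K` also serves `s`. -/
theorem IsLocallySolid.totallyBounded_of_approx (hY : IsLocallySolid Y) {s : Set Y}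
    (h : ∀ V ∈ nhds (0 : Y), ∃ K : Set Y, TotallyBounded K ∧ ∃ v ∈ V,
      ∀ y ∈ s, ∃ k ∈ K, |y - k| ≤ v) : TotallyBounded s := by
  rw [totallyBounded_iff_subset_finite_iUnion_nhds_zero]
  intro U hU
  obtain ⟨V, hV, hVU⟩ := hY.exists_nhds_abs_add hU
  obtain ⟨K, hK, v, hv, hs⟩ := h V hV
  obtain ⟨t, ht, hKt⟩ := totallyBounded_iff_subset_finite_iUnion_nhds_zero.1 hK V hV
  refine ⟨t, ht, fun y hy => ?_⟩
  obtain ⟨k, hk, hyk⟩ := hs y hy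
  obtain ⟨c, hc, w, hw, rfl⟩ := Set.mem_iUnion₂.1 (hKt hk)
  refine Set.mem_iUnion₂.2 ⟨c, hc, y - c, hVU v hv w hw _ ?_, by simp⟩
  have e : y - c = (y - (c + w)) + w := by abel
  rw [e]
  exact (abs_add_le _ _).trans (add_le_add (hyk.trans (le_abs_self v)) le_rfl)

/-- A complete Hausdorff locally solid Lebesgue topology forces Dedekind completeness. -/
theorem IsDedekindComplete.of_completeSpace [ArchimedeanLattice Y] [T2Space Y] [CompleteSpace Y]
    (hsolid : IsLocallySolid Y) (hLebesgue : IsLebesgueTopology Y) : IsDedekindComplete Y := by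
  intro s hs hbdd
  have := hsolid.orderClosedTopology
  suffices ∃ a, IsLUB (supClosure s) a from this.imp fun a ha => isLUB_supClosure.1 ha
  set D := supClosure s with hD
  have hDne : D.Nonempty := hs.mono subset_supClosure
  have hdir : DirectedOn (· ≤ ·) D := supClosed_supClosure.directedOn
  set U := upperBounds D with hU
  have hUne : U.Nonempty := by
    obtain ⟨u, hu⟩ := hbdd
    exact ⟨u, by rw [hU, hD, upperBounds_supClosure]; exact hu⟩
  set W : Set Y := Set.image2 (fun u d => u - d) U D with hW
  have hWglb : IsGLB W 0 := by
    constructor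
    · rintro _ ⟨u, hu, d, hd, rfl⟩
      exact sub_nonneg.2 (hu hd)
    · intro l hl
      -- Lowering an upper bound by $l^+$ leaves an upper bound. Iterating gives $n\,l^+\le u-d$ for
      -- all $n$, so $l^+=0$ by the Archimedean property.
      have hl' : ∀ u ∈ U, u - l ⊔ 0 ∈ U := by
        intro u hu d hd
        have h1 : l ⊔ 0 ≤ u - d := sup_le (hl ⟨u, hu, d, hd, rfl⟩) (sub_nonneg.2 (hu hd))
        exact le_sub_comm.1 h1
      obtain ⟨u, hu⟩ := hUne
      obtain ⟨d, hd⟩ := hDne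
      have hn : ∀ n : ℕ, u - n • (l ⊔ 0) ∈ U := by
        intro n
        induction n with
        | zero => simpa using hu
        | succ n ih => rw [succ_nsmul, ← sub_sub]; exact hl' _ ih
      have h0 := ArchimedeanLattice.eq_zero_of_nsmul_le (l ⊔ 0) (u - d) le_sup_right
        fun n => le_sub_comm.1 (hn n hd)
      exact h0 ▸ le_sup_left
  have hWdir : DirectedOn (fun a b => b ≤ a) W := by
    rintro _ ⟨u, hu, d, hd, rfl⟩ _ ⟨u', hu', d', hd', rfl⟩
    obtain ⟨e, he, h1, h2⟩ := hdir d hd d' hd'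
    exact ⟨u ⊓ u' - e, ⟨u ⊓ u', fun x hx => le_inf (hu hx) (hu' hx), e, he, rfl⟩,
      sub_le_sub inf_le_left h1, sub_le_sub inf_le_right h2⟩
  have : Nonempty D := hDne.to_subtype
  have : IsDirectedOrder D := directedOn_iff_isDirectedOrder.1 hdir
  let F : Filter Y := Filter.map (Subtype.val : D → Y) Filter.atTop
  have hF : Cauchy F := by
    refine ⟨inferInstance, ?_⟩
    rw [uniformity_eq_comap_nhds_zero, ← Filter.tendsto_iff_comap]
    intro V hV
    obtain ⟨V', hV', hsol, hsub⟩ := hsolid V hV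
    -- A tail of the net lies in $[d,u]$, so its differences are dominated by the small element
    -- $u-d$.
    obtain ⟨_, ⟨u, hu, d, hd, rfl⟩, hw⟩ :=
      hLebesgue.exists_mem_nhds (hUne.image2 hDne) hWdir hWglb hV'
    have hev : ∀ᶠ y in F, d ≤ y ∧ y ≤ u :=
      Filter.eventually_map.2 ((Filter.eventually_ge_atTop ⟨d, hd⟩).mono fun e he => ⟨he, hu e.2⟩)
    refine (hev.prod_mk hev).mono ?_
    rintro ⟨x, y⟩ ⟨⟨h1, h2⟩, h3, h4⟩
    refine hsub (hsol hw ((abs_le'.2 ⟨?_, ?_⟩).trans (le_abs_self _)))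
    · exact sub_le_sub h4 h1
    · rw [neg_sub]; exact sub_le_sub h2 h3
  obtain ⟨a, ha⟩ := CompleteSpace.complete hF
  have hlim : Filter.Tendsto (Subtype.val : D → Y) Filter.atTop (nhds a) := ha
  refine ⟨a, fun d hd => ?_, fun u hu => ?_⟩
  · exact ge_of_tendsto hlim ((Filter.eventually_ge_atTop ⟨d, hd⟩).mono fun e he => he)
  · exact le_of_tendsto hlim (Filter.Eventually.of_forall fun e => hu e.2)

end Uniform

end Topology

/-! ### Riesz-Kantorovich formula and the lattice of regular operators -/

section RieszKantorovich

/-- The Riesz decomposition property of lattice ordered groups. -/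
theorem exists_add_eq_of_le_add {G : Type*} [AddCommGroup G] [Lattice G] [IsOrderedAddMonoid G]
    {a b z : G} (hz : 0 ≤ z) (ha : 0 ≤ a) (hb : 0 ≤ b) (h : z ≤ a + b) :
    ∃ z₁ ∈ Set.Icc 0 a, ∃ z₂ ∈ Set.Icc 0 b, z = z₁ + z₂ := by
  refine ⟨z ⊓ a, ⟨le_inf hz ha, inf_le_right⟩, z - z ⊓ a, ⟨sub_nonneg.2 inf_le_left, ?_⟩,
    by abel⟩
  rw [sub_le_comm]
  exact le_inf (sub_le_self z hb) (sub_le_iff_le_add.2 h)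

variable {X : Type*} [AddCommGroup X] [Lattice X] [IsOrderedAddMonoid X] [Module ℝ X]
  [IsOrderedModule ℝ X]
variable {Y : Type*} [AddCommGroup Y] [Lattice Y] [IsOrderedAddMonoid Y] [Module ℝ Y]
  [IsOrderedModule ℝ Y]

/-- A function that is additive and positively homogeneous on the positive cone agrees there with
a linear operator. -/
theorem exists_linearMap_eq_on_nonneg (φ : X → Y)
    (hadd : ∀ x y : X, 0 ≤ x → 0 ≤ y → φ (x + y) = φ x + φ y)
    (hsmul : ∀ c : ℝ, 0 < c → ∀ x : X, 0 ≤ x → φ (c • x) ≤ c • φ x) :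
    ∃ L : X →ₗ[ℝ] Y, ∀ x : X, 0 ≤ x → L x = φ x := by
  have h0 : φ 0 = 0 := by simpa using hadd 0 0 le_rfl le_rfl
  have hsmul' : ∀ c : ℝ, 0 ≤ c → ∀ x : X, 0 ≤ x → φ (c • x) = c • φ x := by
    intro c hc x hx
    rcases hc.eq_or_lt with rfl | hc
    · simp [h0]
    refine le_antisymm (hsmul c hc x hx) ?_
    have h := smul_le_smul_of_nonneg_left
      (hsmul c⁻¹ (inv_pos.2 hc) (c • x) (smul_nonneg hc.le hx)) hc.le
    rwa [smul_smul, smul_smul, inv_mul_cancel₀ hc.ne', mul_inv_cancel₀ hc.ne', one_smul,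
      one_smul] at h
  -- The extension does not depend on how a vector is written as a difference of positive ones.
  have key : ∀ a b : X, 0 ≤ a → 0 ≤ b → φ (a - b)⁺ - φ (a - b)⁻ = φ a - φ b := by
    intro a b ha hb
    have e : (a - b)⁺ + b = a + (a - b)⁻ := by
      have := posPart_sub_negPart (a - b)
      rw [sub_eq_sub_iff_add_eq_add] at this
      exact this
    have := congrArg φ e
    rw [hadd _ _ (posPart_nonneg _) hb, hadd _ _ ha (negPart_nonneg _)] at this
    rwa [sub_eq_sub_iff_add_eq_add]
  refine ⟨{ toFun := fun x => φ x⁺ - φ x⁻, map_add' := ?_, map_smul' := ?_ }, ?_⟩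
  · intro x y
    have e : x + y = (x⁺ + y⁺) - (x⁻ + y⁻) := by
      conv_lhs => rw [← posPart_sub_negPart x, ← posPart_sub_negPart y]
      abel
    have hx := posPart_nonneg x
    have hx' := negPart_nonneg x
    have hy := posPart_nonneg y
    have hy' := negPart_nonneg y
    show φ (x + y)⁺ - φ (x + y)⁻ = _
    rw [e, key _ _ (add_nonneg hx hy) (add_nonneg hx' hy'), hadd _ _ hx hy, hadd _ _ hx' hy']
    abel
  · intro c x
    have hx := posPart_nonneg x
    have hx' := negPart_nonneg x
    show φ (c • x)⁺ - φ (c • x)⁻ = c • (φ x⁺ - φ x⁻)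
    rcases le_total 0 c with hc | hc
    · have e : c • x = c • x⁺ - c • x⁻ := by rw [← smul_sub, posPart_sub_negPart]
      rw [e, key _ _ (smul_nonneg hc hx) (smul_nonneg hc hx'), hsmul' c hc _ hx,
        hsmul' c hc _ hx', smul_sub]
    · have hc' := neg_nonneg.2 hc
      have e : c • x = (-c) • x⁻ - (-c) • x⁺ := by
        conv_lhs => rw [← posPart_sub_negPart x]
        module
      rw [e, key _ _ (smul_nonneg hc' hx') (smul_nonneg hc' hx), hsmul' _ hc' _ hx,
        hsmul' _ hc' _ hx']
      module
  · intro x hx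
    have := key x 0 hx le_rfl
    simpa [h0] using this

theorem IsPositiveOperator.mono {T : X →ₗ[ℝ] Y} (hT : IsPositiveOperator T) {x y : X}
    (h : x ≤ y) : T x ≤ T y := by
  have := hT (y - x) (sub_nonneg.2 h)
  rwa [map_sub, sub_nonneg] at this

/-- The Riesz-Kantorovich formula for the positive part of a regular operator. -/
theorem exists_isLUB_image_Icc (hY : IsDedekindComplete Y) (T : RegularOperators X Y) :
    ∃ P : RegularOperators X Y, ∀ x : X, 0 ≤ x → IsLUB (T.1 '' Set.Icc 0 x) (P.1 x) := by
  obtain ⟨T, A, B, hA, hB, rfl⟩ := T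
  have hex : ∀ x : X, ∃ y : Y, 0 ≤ x → IsLUB ((A - B) '' Set.Icc 0 x) y := by
    intro x
    by_cases hx : 0 ≤ x
    · obtain ⟨y, hy⟩ := hY ((A - B) '' Set.Icc 0 x) ⟨_, 0, ⟨le_rfl, hx⟩, rfl⟩
        ⟨A x, by
          rintro _ ⟨z, hz, rfl⟩
          exact (sub_le_self _ (hB z hz.1)).trans (hA.mono hz.2)⟩
      exact ⟨y, fun _ => hy⟩
    · exact ⟨0, fun h => (hx h).elim⟩
  choose φ hφ using hex
  obtain ⟨P, hP⟩ := exists_linearMap_eq_on_nonneg φ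
    (by
      intro x y hx hy
      refine le_antisymm ((hφ _ (add_nonneg hx hy)).2 ?_) ?_
      · rintro _ ⟨z, hz, rfl⟩
        obtain ⟨u, hu, v, hv, rfl⟩ := exists_add_eq_of_le_add hz.1 hx hy hz.2
        rw [map_add]
        exact add_le_add ((hφ x hx).1 ⟨u, hu, rfl⟩) ((hφ y hy).1 ⟨v, hv, rfl⟩)
      · rw [← le_sub_iff_add_le]
        refine (hφ x hx).2 ?_
        rintro _ ⟨u, hu, rfl⟩
        rw [le_sub_comm]
        refine (hφ y hy).2 ?_
        rintro _ ⟨v, hv, rfl⟩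
        rw [le_sub_iff_add_le', ← map_add]
        exact (hφ _ (add_nonneg hx hy)).1
          ⟨u + v, ⟨add_nonneg hu.1 hv.1, add_le_add hu.2 hv.2⟩, rfl⟩)
    (by
      intro c hc x hx
      refine (hφ _ (smul_nonneg hc.le hx)).2 ?_
      rintro _ ⟨z, hz, rfl⟩
      have hz' : c⁻¹ • z ∈ Set.Icc 0 x := by
        refine ⟨smul_nonneg (inv_pos.2 hc).le hz.1, ?_⟩
        have := smul_le_smul_of_nonneg_left hz.2 (inv_pos.2 hc).le
        rwa [smul_smul, inv_mul_cancel₀ hc.ne', one_smul] at this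
      have := smul_le_smul_of_nonneg_left ((hφ x hx).1 ⟨_, hz', rfl⟩) hc.le
      rwa [map_smul, smul_smul, mul_inv_cancel₀ hc.ne', one_smul] at this)
  have hlub : ∀ x : X, 0 ≤ x → IsLUB ((A - B) '' Set.Icc 0 x) (P x) :=
    fun x hx => hP x hx ▸ hφ x hx
  refine ⟨⟨P, P, 0, fun x hx => ?_, fun _ _ => le_rfl, by simp⟩, hlub⟩
  have := (hlub x hx).1 ⟨0, ⟨le_rfl, hx⟩, rfl⟩
  rwa [map_zero] at this

/-- A directed family of regular operators that is bounded above has a pointwise supremum. -/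
theorem exists_pointwise_isLUB (hY : IsDedekindComplete Y) {D : Set (RegularOperators X Y)}
    (hne : D.Nonempty) (hdir : DirectedOn (· ≤ ·) D) (hbdd : BddAbove D) :
    ∃ a : RegularOperators X Y, ∀ x : X, 0 ≤ x →
      IsLUB ((fun T : RegularOperators X Y => T.1 x) '' D) (a.1 x) := by
  obtain ⟨b, hb⟩ := hbdd
  obtain ⟨T₀, hT₀⟩ := hne
  have hex : ∀ x : X, ∃ y : Y, 0 ≤ x →
      IsLUB ((fun T : RegularOperators X Y => T.1 x) '' D) y := by
    intro x
    by_cases hx : 0 ≤ x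
    · obtain ⟨y, hy⟩ := hY ((fun T : RegularOperators X Y => T.1 x) '' D) ⟨_, T₀, hT₀, rfl⟩
        ⟨b.1 x, by
          rintro _ ⟨T, hT, rfl⟩
          exact hb hT x hx⟩
      exact ⟨y, fun _ => hy⟩
    · exact ⟨0, fun h => (hx h).elim⟩
  choose φ hφ using hex
  obtain ⟨P, hP⟩ := exists_linearMap_eq_on_nonneg φ
    (by
      intro x y hx hy
      refine le_antisymm ((hφ _ (add_nonneg hx hy)).2 ?_) ?_
      · rintro _ ⟨T, hT, rfl⟩
        show T.1 (x + y) ≤ _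
        rw [map_add]
        exact add_le_add ((hφ x hx).1 ⟨T, hT, rfl⟩) ((hφ y hy).1 ⟨T, hT, rfl⟩)
      · rw [← le_sub_iff_add_le]
        refine (hφ x hx).2 ?_
        rintro _ ⟨S, hS, rfl⟩
        rw [le_sub_comm]
        refine (hφ y hy).2 ?_
        rintro _ ⟨T, hT, rfl⟩
        -- Directedness is what makes the pointwise supremum superadditive.
        obtain ⟨R, hR, hSR, hTR⟩ := hdir S hS T hT
        rw [le_sub_iff_add_le']
        refine (add_le_add (hSR x hx) (hTR y hy)).trans ?_
        rw [← map_add]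
        exact (hφ _ (add_nonneg hx hy)).1 ⟨R, hR, rfl⟩)
    (by
      intro c hc x hx
      refine (hφ _ (smul_nonneg hc.le hx)).2 ?_
      rintro _ ⟨T, hT, rfl⟩
      show T.1 (c • x) ≤ _
      rw [map_smul]
      exact smul_le_smul_of_nonneg_left ((hφ x hx).1 ⟨T, hT, rfl⟩) hc.le)
  have hlub : ∀ x : X, 0 ≤ x →
      IsLUB ((fun T : RegularOperators X Y => T.1 x) '' D) (P x) :=
    fun x hx => hP x hx ▸ hφ x hx
  have hreg : P ∈ RegularOperators X Y := by
    have h1 : P - T₀.1 ∈ RegularOperators X Y := by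
      refine ⟨P - T₀.1, 0, fun x hx => ?_, fun _ _ => le_rfl, by simp⟩
      exact sub_nonneg.2 ((hlub x hx).1 ⟨T₀, hT₀, rfl⟩)
    simpa using add_mem h1 T₀.2
  exact ⟨⟨P, hreg⟩, hlub⟩

theorem isLUB_of_pointwise {D : Set (RegularOperators X Y)} {a : RegularOperators X Y}
    (h : ∀ x : X, 0 ≤ x → IsLUB ((fun T : RegularOperators X Y => T.1 x) '' D) (a.1 x)) :
    IsLUB D a := by
  refine ⟨fun T hT x hx => (h x hx).1 ⟨T, hT, rfl⟩, fun b hb x hx => (h x hx).2 ?_⟩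
  rintro _ ⟨T, hT, rfl⟩
  exact hb hT x hx

namespace RegularOperators

/-- The positive part of a regular operator, given by the Riesz-Kantorovich formula. -/
noncomputable def rkPosPart (hY : IsDedekindComplete Y) (T : RegularOperators X Y) :
    RegularOperators X Y :=
  (exists_isLUB_image_Icc hY T).choose

theorem isLUB_rkPosPart (hY : IsDedekindComplete Y) (T : RegularOperators X Y) {x : X}
    (hx : 0 ≤ x) : IsLUB (T.1 '' Set.Icc 0 x) ((rkPosPart hY T).1 x) :=
  (exists_isLUB_image_Icc hY T).choose_spec x hx

theorem le_rkPosPart (hY : IsDedekindComplete Y) (T : RegularOperators X Y) :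
    T ≤ rkPosPart hY T :=
  fun x hx => (isLUB_rkPosPart hY T hx).1 ⟨x, ⟨hx, le_rfl⟩, rfl⟩

theorem rkPosPart_nonneg (hY : IsDedekindComplete Y) (T : RegularOperators X Y) :
    0 ≤ rkPosPart hY T := fun x hx => by
  have := (isLUB_rkPosPart hY T hx).1 ⟨0, ⟨le_rfl, hx⟩, rfl⟩
  rwa [map_zero] at this

theorem rkPosPart_le (hY : IsDedekindComplete Y) {T R : RegularOperators X Y} (hT : T ≤ R)
    (h0 : 0 ≤ R) : rkPosPart hY T ≤ R := fun x hx => by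
  refine (isLUB_rkPosPart hY T hx).2 ?_
  rintro _ ⟨z, hz, rfl⟩
  have hR : IsPositiveOperator R.1 := fun x hx => h0 x hx
  exact (hT z hz.1).trans (hR.mono hz.2)

/-- Regular operators into a Dedekind complete vector lattice form a lattice. -/
@[reducible] noncomputable def lattice (hY : IsDedekindComplete Y) :
    Lattice (RegularOperators X Y) where
  __ := RegularOperators.instPartialOrder
  sup S T := T + rkPosPart hY (S - T)
  inf S T := S - rkPosPart hY (S - T)
  le_sup_left S T := sub_le_iff_le_add'.1 (le_rkPosPart hY (S - T))
  le_sup_right S T := le_add_of_nonneg_right (rkPosPart_nonneg hY (S - T))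
  sup_le S T R hS hT :=
    le_sub_iff_add_le'.1 (rkPosPart_le hY (sub_le_sub_right hS T) (sub_nonneg.2 hT))
  inf_le_left S T := sub_le_self _ (rkPosPart_nonneg hY (S - T))
  inf_le_right S T := sub_le_comm.1 (le_rkPosPart hY (S - T))
  le_inf R S T hS hT :=
    le_sub_comm.1 (rkPosPart_le hY (sub_le_sub_left hT S) (sub_nonneg.2 hS))

end RegularOperators

end RieszKantorovich

/-! ### Compact operators and the disjointness argument -/

section OTauCompact

variable {X : Type*} [AddCommGroup X] [Lattice X] [IsOrderedAddMonoid X] [Module ℝ X]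
  [IsOrderedModule ℝ X]
variable {Y : Type*} [AddCommGroup Y] [Lattice Y] [IsOrderedAddMonoid Y] [Module ℝ Y]
  [IsOrderedModule ℝ Y] [UniformSpace Y] [IsUniformAddGroup Y]

theorem IsOTauCompact.zero : IsOTauCompact (0 : X →ₗ[ℝ] Y) := fun _ _ =>
  totallyBounded_singleton (0 : Y) |>.subset (by rintro _ ⟨z, -, rfl⟩; simp)

theorem IsOTauCompact.add (hY : IsLocallySolid Y) {S T : X →ₗ[ℝ] Y} (hS : IsOTauCompact S)
    (hT : IsOTauCompact T) : IsOTauCompact (S + T) := fun x hx => by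
  refine (hY.totallyBounded_image2 (f := (· + ·)) (fun a b c d => ?_) (hS x hx) (hT x hx)).subset ?_
  · rw [add_sub_add_comm]
    exact abs_add_le _ _
  · rintro _ ⟨z, hz, rfl⟩
    exact ⟨S z, ⟨z, hz, rfl⟩, T z, ⟨z, hz, rfl⟩, rfl⟩

theorem IsOTauCompact.smul [ContinuousSMul ℝ Y] (c : ℝ) {T : X →ₗ[ℝ] Y} (hT : IsOTauCompact T) :
    IsOTauCompact (c • T) := fun x hx => by
  have : UniformContinuousConstSMul ℝ Y := uniformContinuousConstSMul_of_continuousConstSMul ℝ Y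
  refine ((hT x hx).image (uniformContinuous_const_smul c)).subset ?_
  rintro _ ⟨z, hz, rfl⟩
  exact ⟨T z, ⟨z, hz, rfl⟩, rfl⟩

theorem IsOTauCompact.sub [ContinuousSMul ℝ Y] (hY : IsLocallySolid Y) {S T : X →ₗ[ℝ] Y}
    (hS : IsOTauCompact S) (hT : IsOTauCompact T) : IsOTauCompact (S - T) := by
  have := hS.add hY (hT.smul (-1))
  rwa [neg_one_smul, ← sub_eq_add_neg] at this

theorem IsOTauCompact.of_approx (hY : IsLocallySolid Y) {S : X →ₗ[ℝ] Y}
    (h : ∀ x : X, 0 ≤ x → ∀ V ∈ nhds (0 : Y), ∃ R : X →ₗ[ℝ] Y, IsOTauCompact R ∧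
      ∃ v ∈ V, ∀ z ∈ Set.Icc 0 x, |S z - R z| ≤ v) : IsOTauCompact S := fun x hx => by
  refine hY.totallyBounded_of_approx fun V hV => ?_
  obtain ⟨R, hR, v, hv, hSR⟩ := h x hx V hV
  refine ⟨_, hR x hx, v, hv, ?_⟩
  rintro _ ⟨z, hz, rfl⟩
  exact ⟨R z, ⟨z, hz, rfl⟩, hSR z hz⟩

/-- If `A` and `B` are disjoint positive operators and `T` is an `oτ`-compact operator that differs
from `A` by at most `B`, then `A` is `oτ`-compact. -/
theorem IsOTauCompact.of_disjoint (hsolid : IsLocallySolid Y) (hLebesgue : IsLebesgueTopology Y)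
    {A B T : X →ₗ[ℝ] Y} (hA : IsPositiveOperator A) (hB : IsPositiveOperator B)
    (hAB : ∀ x : X, 0 ≤ x → IsLUB ((A - B) '' Set.Icc 0 x) (A x))
    (hTA : ∀ z : X, 0 ≤ z → |T z - A z| ≤ B z) (hT : IsOTauCompact T) : IsOTauCompact A := by
  intro x hx
  refine hsolid.totallyBounded_of_approx fun V hV => ?_
  -- `Q` collects the errors with which $A[0,x]$ is approximable from below by a totally bounded
  -- set; `W` holds the errors $2(A(x-y)+By)$.
  let Q : Set Y := {w | ∃ K : Set Y, TotallyBounded K ∧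
    ∀ z ∈ Set.Icc 0 x, ∃ k ∈ K, k ≤ A z ∧ A z ≤ k + w}
  let W : Set Y := (fun y => (2 : ℝ) • (A x - (A - B) y)) '' Set.Icc 0 x
  have hWQ : W ⊆ Q := by
    rintro _ ⟨y, hy, rfl⟩
    set w := A x - (A - B) y with hw
    have hw' : w = A (x - y) + B y := by simp [hw]; abel
    refine ⟨(fun t => t - w) '' (T '' Set.Icc 0 x),
      (hT x hx).image (uniformContinuous_id.sub uniformContinuous_const), fun z hz => ?_⟩
    obtain ⟨z₁, hz₁, z₂, hz₂, rfl⟩ := exists_add_eq_of_le_add hz.1 (sub_nonneg.2 hy.2) hy.1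
      (by simpa using hz.2)
    refine ⟨T z₂ - w, ⟨T z₂, ⟨z₂, ⟨hz₂.1, hz₂.2.trans hy.2⟩, rfl⟩, rfl⟩, ?_⟩
    have habs := abs_le'.1 (hTA z₂ hz₂.1)
    have h1 : A z₁ ≤ A (x - y) := hA.mono hz₁.2
    have h2 : B z₂ ≤ B y := hB.mono hz₂.2
    have h3 : 0 ≤ A z₁ := hA _ hz₁.1
    have h4 : 0 ≤ A (x - y) := h3.trans h1
    have h5 : T z₂ - A z₂ ≤ B y := habs.1.trans h2
    have h6 : A z₂ - T z₂ ≤ B y := by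
      rw [← neg_sub]
      exact habs.2.trans h2
    show T z₂ - w ≤ A (z₁ + z₂) ∧ A (z₁ + z₂) ≤ T z₂ - w + (2 : ℝ) • w
    rw [map_add, two_smul, hw']
    constructor
    · rw [sub_le_iff_le_add]
      calc T z₂ ≤ B y + A z₂ := sub_le_iff_le_add.1 h5
        _ ≤ B y + A z₂ + (A z₁ + A (x - y)) := le_add_of_nonneg_right (add_nonneg h3 h4)
        _ = _ := by abel
    · calc A z₁ + A z₂ ≤ A (x - y) + (B y + T z₂) := add_le_add h1 (sub_le_iff_le_add.1 h6)
        _ = _ := by abel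
  have hQ : InfClosed Q := by
    rintro w ⟨K, hK, hw⟩ w' ⟨K', hK', hw'⟩
    refine ⟨Set.image2 (· ⊔ ·) K K',
      hsolid.totallyBounded_image2 abs_sup_sub_sup_le_add hK hK', fun z hz => ?_⟩
    obtain ⟨k, hk, h1, h2⟩ := hw z hz
    obtain ⟨k', hk', h1', h2'⟩ := hw' z hz
    refine ⟨k ⊔ k', Set.mem_image2_of_mem hk hk', sup_le h1 h1', ?_⟩
    rw [add_inf]
    exact le_inf (h2.trans (add_le_add_left le_sup_left _))
      (h2'.trans (add_le_add_left le_sup_right _))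
  -- `hAB` is disjointness in the form $(A-B)^+=A$.
  have hWglb : IsGLB W 0 := by
    constructor
    · rintro _ ⟨y, hy, rfl⟩
      exact smul_nonneg zero_le_two (sub_nonneg.2 ((hAB x hx).1 ⟨y, hy, rfl⟩))
    · intro l hl
      have h : A x ≤ A x - (2⁻¹ : ℝ) • l := by
        refine (hAB x hx).2 ?_
        rintro _ ⟨y, hy, rfl⟩
        have h1 := smul_le_smul_of_nonneg_left (hl ⟨y, hy, rfl⟩)
          (by norm_num : (0 : ℝ) ≤ 2⁻¹)
        simp only [smul_smul] at h1
        rw [inv_mul_cancel₀ two_ne_zero, one_smul] at h1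
        exact le_sub_comm.1 h1
      have h2 : (2⁻¹ : ℝ) • l ≤ 0 := by simpa using h
      have h3 := smul_le_smul_of_nonneg_left h2 (zero_le_two (α := ℝ))
      rwa [smul_smul, mul_inv_cancel₀ two_ne_zero, one_smul, smul_zero] at h3
  have hWne : W.Nonempty := ⟨_, 0, ⟨le_rfl, hx⟩, rfl⟩
  obtain ⟨w, hw, hwV⟩ := hLebesgue.exists_mem_nhds (hWne.mono subset_infClosure)
    infClosed_infClosure.codirectedOn (isGLB_infClosure.2 hWglb) hV
  obtain ⟨K, hK, hKw⟩ := infClosure_min hWQ hQ hw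
  refine ⟨K, hK, w, hwV, ?_⟩
  rintro _ ⟨z, hz, rfl⟩
  obtain ⟨k, hk, h1, h2⟩ := hKw z hz
  refine ⟨k, hk, ?_⟩
  rw [abs_of_nonneg (sub_nonneg.2 h1)]
  exact sub_le_iff_le_add'.2 h2

end OTauCompact

/-! ### Components in a vector lattice -/

section Components

variable {E : Type*} [AddCommGroup E] [Lattice E] [IsOrderedAddMonoid E]

theorem add_inf_eq_zero {a b c : E} (ha : 0 ≤ a) (hb : 0 ≤ b) (hc : 0 ≤ c) (hac : a ⊓ c = 0)
    (hbc : b ⊓ c = 0) : (a + b) ⊓ c = 0 := by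
  refine le_antisymm ?_ (le_inf (add_nonneg ha hb) hc)
  rw [← hac]
  refine le_inf ?_ inf_le_right
  calc (a + b) ⊓ c ≤ (a + b) ⊓ (a + c) := inf_le_inf_left _ (le_add_of_nonneg_left ha)
    _ = a := by rw [← add_inf, hbc, add_zero]

theorem nsmul_inf_eq_zero {a c : E} (ha : 0 ≤ a) (hc : 0 ≤ c) (hac : a ⊓ c = 0) (n : ℕ) :
    (n • a) ⊓ c = 0 := by
  induction n with
  | zero => simpa using hc
  | succ n ih => rw [succ_nsmul]; exact add_inf_eq_zero (nsmul_nonneg ha n) ha hc ih hac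

/-- The component of `t` in the band generated by `(2s - t)⁺`. -/
theorem component_of_isLUB {s t c : E} (hs : 0 ≤ s) (hst : s ≤ t)
    (hc : IsLUB (Set.range fun n : ℕ => (n • (s + s - t)⁺) ⊓ t) c) :
    0 ≤ c ∧ c ≤ t ∧ s + s - t ≤ c ∧ c ≤ s + s ∧ c ⊓ (t - c) = 0 := by
  set d := s + s - t with hd
  have hcn : ∀ n : ℕ, (n • d⁺) ⊓ t ≤ c := fun n => hc.1 ⟨n, rfl⟩
  have hd0 : 0 ≤ d⁺ := posPart_nonneg d
  have ht : 0 ≤ t := hs.trans hst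
  have h0 : 0 ≤ c := by simpa [inf_eq_left.2 ht] using hcn 0
  have hct : c ≤ t := hc.2 (by rintro _ ⟨n, rfl⟩; exact inf_le_right)
  have hdt : d⁺ ≤ t := sup_le (sub_le_iff_le_add.2 (add_le_add hst hst)) ht
  refine ⟨h0, hct, ?_, hc.2 ?_, ?_⟩
  · have h1 := hcn 1
    rw [one_nsmul, inf_eq_left.2 hdt] at h1
    exact (le_posPart d).trans h1
  · rintro _ ⟨n, rfl⟩
    have h := nsmul_inf_eq_zero hd0 (negPart_nonneg d) (posPart_inf_negPart_eq_zero d) n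
    have h1 : t ≤ s + s + d⁻ := by
      have : t = s + s + -d := by rw [hd]; abel
      rw [this]
      exact add_le_add le_rfl (neg_le_negPart d)
    calc (n • d⁺) ⊓ t ≤ (s + s + n • d⁺) ⊓ (s + s + d⁻) :=
          inf_le_inf (le_add_of_nonneg_left (add_nonneg hs hs)) h1
      _ = s + s := by rw [← add_inf, h, add_zero]
  · refine le_antisymm ?_ (le_inf h0 (sub_nonneg.2 hct))
    -- The goal amounts to $2c\wedge t\le c$. Terms $p,q$ of the sequence satisfy $(p+q)\wedge t\le
    -- c$, as $p+q\le(n+m)d^+$; then take suprema over $n$ and $m$ separately.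
    set e := (c + c) ⊓ t with he
    have hnm : ∀ n m : ℕ, (n • d⁺) ⊓ t + (m • d⁺) ⊓ t ≤ c + (c + c) - e := by
      intro n m
      set p := (n • d⁺) ⊓ t with hp
      set q := (m • d⁺) ⊓ t with hq
      have h1 : (p + q) ⊓ t ≤ c := by
        refine le_trans (inf_le_inf_right t ?_) (hcn (n + m))
        rw [add_nsmul]
        exact add_le_add inf_le_left inf_le_left
      have h2 : e ≤ ((c - p) + (c - q)) + (p + q) ⊓ t := by
        rw [add_inf]
        refine inf_le_inf (le_of_eq (by abel)) (le_add_of_nonneg_left ?_)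
        exact add_nonneg (sub_nonneg.2 (hcn n)) (sub_nonneg.2 (hcn m))
      have h3 : e ≤ ((c - p) + (c - q)) + c := h2.trans (add_le_add le_rfl h1)
      rw [le_sub_comm]
      refine h3.trans (le_of_eq ?_)
      abel
    have hcc : c + c ≤ c + (c + c) - e := by
      rw [← le_sub_iff_add_le]
      refine hc.2 ?_
      rintro _ ⟨n, rfl⟩
      rw [le_sub_comm]
      refine hc.2 ?_
      rintro _ ⟨m, rfl⟩
      rw [le_sub_iff_add_le']
      exact hnm n m
    have hec : e ≤ c := by
      have := le_sub_comm.1 hcc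
      simpa using this
    have : c ⊓ (t - c) = e - c := by
      rw [he, inf_sub]
      simp
    rw [this]
    exact sub_nonpos.2 hec

end Components

/-! ### Solidity and directed suprema -/

section Band

variable {X : Type*} [AddCommGroup X] [Lattice X] [IsOrderedAddMonoid X] [Module ℝ X]
  [IsOrderedModule ℝ X]
variable {Y : Type*} [AddCommGroup Y] [Lattice Y] [IsOrderedAddMonoid Y] [Module ℝ Y]
  [IsOrderedModule ℝ Y]

/-- If `0 ≤ S ≤ T`, then `T` has a component `C` with `0 ≤ S - C / 2 ≤ T / 2`. -/
theorem RegularOperators.exists_component (hY : IsDedekindComplete Y)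
    {S T : RegularOperators X Y} (hS : 0 ≤ S) (hST : S ≤ T) :
    ∃ C : RegularOperators X Y, 0 ≤ C ∧ C ≤ T ∧ S + S - T ≤ C ∧ C ≤ S + S ∧
      ∀ x : X, 0 ≤ x → IsLUB ((C.1 - (T - C).1) '' Set.Icc 0 x) (C.1 x) := by
  let _ := RegularOperators.lattice (X := X) hY
  have hmono : Monotone fun n : ℕ => (n • (S + S - T)⁺) ⊓ T := fun n m h =>
    inf_le_inf_right T (nsmul_le_nsmul_left (posPart_nonneg _) h)
  obtain ⟨C, hC⟩ := exists_pointwise_isLUB hY (Set.range_nonempty _)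
    (directedOn_range.2 hmono.directed_le) ⟨T, by rintro _ ⟨n, rfl⟩; exact inf_le_right⟩
  obtain ⟨h1, h2, h3, h4, h5⟩ := component_of_isLUB hS hST (isLUB_of_pointwise hC)
  refine ⟨C, h1, h2, h3, h4, fun x hx => ?_⟩
  -- The infimum is by definition $U\wedge V=U-(U-V)^+$, so disjointness reads $(C-(T-C))^+=C$.
  have h6 : C - rkPosPart hY (C - (T - C)) = 0 := h5
  have h7 := isLUB_rkPosPart hY (C - (T - C)) hx
  rw [← sub_eq_zero.1 h6] at h7
  exact h7

variable [UniformSpace Y] [IsUniformAddGroup Y]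

/-- $T^+$ and $T^-=T^+-T$ are disjoint, and $T$ differs from $T^+$ by exactly $T^-$. -/
theorem IsOTauCompact.rkPosPart (hsolid : IsLocallySolid Y) (hLebesgue : IsLebesgueTopology Y)
    (hY : IsDedekindComplete Y) {T : RegularOperators X Y} (hT : IsOTauCompact T.1) :
    IsOTauCompact (RegularOperators.rkPosPart hY T).1 := by
  set A := RegularOperators.rkPosPart hY T with hA
  have hTA : ∀ z : X, 0 ≤ z → T.1 z ≤ A.1 z := RegularOperators.le_rkPosPart hY T
  refine IsOTauCompact.of_disjoint hsolid hLebesgue (B := A.1 - T.1)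
    (fun x hx => RegularOperators.rkPosPart_nonneg hY T x hx)
    (fun x hx => sub_nonneg.2 (hTA x hx)) (fun x hx => ?_) (fun z hz => ?_) hT
  · rw [sub_sub_cancel]
    exact RegularOperators.isLUB_rkPosPart hY T hx
  · rw [abs_sub_comm, abs_of_nonneg (sub_nonneg.2 (hTA z hz))]
    rfl

variable [ContinuousSMul ℝ Y]

/-- A positive operator dominated by an `oτ`-compact operator `T` is approximated by
`oτ`-compact operators up to arbitrarily small multiples of `T`. -/
theorem IsOTauCompact.exists_approx_of_le (hsolid : IsLocallySolid Y)
    (hLebesgue : IsLebesgueTopology Y) (hY : IsDedekindComplete Y) {T : RegularOperators X Y}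
    (hT : IsOTauCompact T.1) (n : ℕ) : ∀ S : RegularOperators X Y, 0 ≤ S → S ≤ T →
      ∃ R : RegularOperators X Y, IsOTauCompact R.1 ∧ R ≤ S ∧ S ≤ R + (2⁻¹ : ℝ) ^ n • T := by
  induction n with
  | zero => exact fun S hS hST => ⟨0, IsOTauCompact.zero, hS, by simpa using hST⟩
  | succ n ih =>
    intro S hS hST
    obtain ⟨C, hC0, hCT, hSC, hCS, hC⟩ := RegularOperators.exists_component hY hS hST
    have hCc : IsOTauCompact C.1 := by
      refine IsOTauCompact.of_disjoint hsolid hLebesgue (B := (T - C).1) (fun x hx => hC0 x hx)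
        (fun x hx => sub_nonneg.2 (hCT x hx)) hC (fun z hz => ?_) hT
      rw [abs_of_nonneg (sub_nonneg.2 (hCT z hz))]
      rfl
    -- The remainder $2S-C$ again lies in $[0,T]$; halving its approximation gains a factor $1/2$.
    obtain ⟨R, hR, hRS, hSR⟩ := ih (S + S - C) (sub_nonneg.2 hCS) (sub_le_comm.1 hSC)
    refine ⟨(2⁻¹ : ℝ) • (C + R), (hCc.add hsolid hR).smul _, ?_, ?_⟩
    · have h := smul_le_smul_of_nonneg_left (le_sub_iff_add_le'.1 hRS)
        (by norm_num : (0 : ℝ) ≤ 2⁻¹)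
      refine h.trans (le_of_eq ?_)
      module
    · have h := smul_le_smul_of_nonneg_left (sub_le_iff_le_add.1 hSR)
        (by norm_num : (0 : ℝ) ≤ 2⁻¹)
      have e : S = (2⁻¹ : ℝ) • (S + S) := by module
      rw [e]
      refine h.trans (le_of_eq ?_)
      rw [pow_succ]
      module

theorem IsOTauCompact.of_le (hsolid : IsLocallySolid Y)
    (hLebesgue : IsLebesgueTopology Y) (hY : IsDedekindComplete Y) {S T : RegularOperators X Y}
    (hT : IsOTauCompact T.1) (hS : 0 ≤ S) (hST : S ≤ T) : IsOTauCompact S.1 := by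
  refine IsOTauCompact.of_approx hsolid fun x hx V hV => ?_
  have hlim : Filter.Tendsto (fun n : ℕ => (2⁻¹ : ℝ) ^ n • T.1 x) Filter.atTop (nhds 0) := by
    have := (tendsto_pow_atTop_nhds_zero_of_lt_one (by norm_num : (0 : ℝ) ≤ 2⁻¹)
      (by norm_num)).smul_const (T.1 x)
    rwa [zero_smul] at this
  obtain ⟨n, hn⟩ := (hlim.eventually_mem hV).exists
  obtain ⟨R, hR, hRS, hSR⟩ := hT.exists_approx_of_le hsolid hLebesgue hY n S hS hST
  refine ⟨R.1, hR, _, hn, fun z hz => ?_⟩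
  have hTpos : IsPositiveOperator T.1 := fun y hy => (hS.trans hST) y hy
  rw [abs_of_nonneg (sub_nonneg.2 (hRS z hz.1))]
  have h1 : S.1 z ≤ R.1 z + (2⁻¹ : ℝ) ^ n • T.1 z := hSR z hz.1
  exact (sub_le_iff_le_add'.2 h1).trans
    (smul_le_smul_of_nonneg_left (hTpos.mono hz.2) (by positivity))

/-- For $T\in D$ the operator $a-T$ is positive, so its value at $x$ bounds the error on all of
$[0,x]$. -/
theorem IsOTauCompact.of_directed_isLUB (hsolid : IsLocallySolid Y)
    (hLebesgue : IsLebesgueTopology Y) (hY : IsDedekindComplete Y)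
    {D : Set (RegularOperators X Y)} (hne : D.Nonempty) (hdir : DirectedOn (· ≤ ·) D)
    (hD : ∀ T ∈ D, IsOTauCompact T.1) {a : RegularOperators X Y} (ha : IsLUB D a) :
    IsOTauCompact a.1 := by
  obtain ⟨a', ha'⟩ := exists_pointwise_isLUB hY hne hdir ⟨a, ha.1⟩
  obtain rfl := ha.unique (isLUB_of_pointwise ha')
  refine IsOTauCompact.of_approx hsolid fun x hx V hV => ?_
  let W : Set Y := (fun T : RegularOperators X Y => a.1 x - T.1 x) '' D
  have hW : IsGLB W 0 := by
    constructor
    · rintro _ ⟨T, hT, rfl⟩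
      exact sub_nonneg.2 (ha.1 hT x hx)
    · intro l hl
      have h : a.1 x ≤ a.1 x - l := by
        refine (ha' x hx).2 ?_
        rintro _ ⟨T, hT, rfl⟩
        exact le_sub_comm.1 (hl ⟨T, hT, rfl⟩)
      simpa using h
  have hWdir : DirectedOn (fun u v => v ≤ u) W := by
    rintro _ ⟨S, hS, rfl⟩ _ ⟨T, hT, rfl⟩
    obtain ⟨R, hR, hSR, hTR⟩ := hdir S hS T hT
    exact ⟨_, ⟨R, hR, rfl⟩, sub_le_sub_left (hSR x hx) _, sub_le_sub_left (hTR x hx) _⟩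
  obtain ⟨_, ⟨T, hT, rfl⟩, hTV⟩ := hLebesgue.exists_mem_nhds (hne.image _) hWdir hW hV
  refine ⟨T.1, hD T hT, _, hTV, fun z hz => ?_⟩
  have hpos : IsPositiveOperator (a.1 - T.1) := fun y hy => sub_nonneg.2 (ha.1 hT y hy)
  rw [abs_of_nonneg (sub_nonneg.2 (ha.1 hT z hz.1))]
  exact hpos.mono hz.2

end Band

theorem mainTheorem6
    {X : Type*} [AddCommGroup X] [Lattice X] [IsOrderedAddMonoid X] [Module ℝ X]
    [IsOrderedModule ℝ X] [ArchimedeanLattice X]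
    {Y : Type*} [AddCommGroup Y] [Lattice Y] [IsOrderedAddMonoid Y] [Module ℝ Y]
    [IsOrderedModule ℝ Y] [ArchimedeanLattice Y]
    [UniformSpace Y] [IsUniformAddGroup Y] [ContinuousSMul ℝ Y] [T2Space Y]
    [LocallyConvexSpace ℝ Y]
    (hsolid : IsLocallySolid Y) (hLebesgue : IsLebesgueTopology Y)
    (hcomplete : IsDedekindComplete Y ∨ CompleteSpace Y) :
    ∃ L : Lattice (RegularOperators X Y),
      L.toPartialOrder = RegularOperators.instPartialOrder ∧
      IsBand {T : RegularOperators X Y | IsOTauCompact (T : X →ₗ[ℝ] Y)} := by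
  have hY : IsDedekindComplete Y :=
    hcomplete.elim id fun _ => IsDedekindComplete.of_completeSpace hsolid hLebesgue
  letI L := RegularOperators.lattice (X := X) hY
  refine ⟨L, rfl, ?_⟩
  have hsup : SupClosed {T : RegularOperators X Y | IsOTauCompact (T : X →ₗ[ℝ] Y)} :=
    fun S hS T hT => hT.add hsolid
      (IsOTauCompact.rkPosPart hsolid hLebesgue hY (T := S - T) (hS.sub hsolid hT))
  refine ⟨IsOTauCompact.zero, fun hS hT => hS.add hsolid hT, fun c T hT => hT.smul c, ?_, ?_⟩
  · intro T hT S hST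
    have hTneg : IsOTauCompact (-T).1 := by
      have := hT.smul (-1)
      rwa [neg_one_smul] at this
    have habs : IsOTauCompact (|T|).1 := hsup hT hTneg
    have hpos : IsOTauCompact (S⁺).1 := habs.of_le hsolid hLebesgue hY (posPart_nonneg S)
      ((sup_le (le_abs_self S) (abs_nonneg S)).trans hST)
    have hneg : IsOTauCompact (S⁻).1 := habs.of_le hsolid hLebesgue hY (negPart_nonneg S)
      ((sup_le (neg_le_abs S) (abs_nonneg S)).trans hST)
    have h := hpos.sub hsolid hneg
    have e : S⁺.1 - S⁻.1 = S.1 := congrArg Subtype.val (posPart_sub_negPart S)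
    rwa [e] at h
  · intro D a hD ha
    -- A supremum of the empty set is a least element, hence zero. Otherwise closing `D` under
    -- finite suprema makes it directed without changing its supremum.
    rcases D.eq_empty_or_nonempty with rfl | hne
    · have hbot : ∀ b, a ≤ b := fun b => ha.2 (by simp)
      have h0 : a = 0 := le_antisymm (hbot 0) (le_add_iff_nonneg_left a |>.1 (hbot (a + a)))
      rw [h0]
      exact IsOTauCompact.zero
    · exact IsOTauCompact.of_directed_isLUB hsolid hLebesgue hY (hne.mono subset_supClosure)
        supClosed_supClosure.directedOn (fun T hT => supClosure_min hD hsup hT)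
        (isLUB_supClosure.2 ha)
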